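/- Let $\mathbb{F}$ be a finite field, let $E/\mathbb{F}$ be an elliptic curve given by a Weierstrass equation $y^2+a_1xy+a_3y=x^3+a_2x^2+a_4x+a_6$, and let $P\in E(\mathbb{F})$ be a point of exact order $r\ge 2$. For $n\ge 0$ let $F_n$ be the $n$-division polynomial of $E$, normalized relative to the uniformizer $z=-x/y$ at $\mathcal{O}$: $F_n=(-1)^{n+1}\psi_n$, where $\psi_n$ is the classical division polynomial, i.e. $\psi_0=0$, $\psi_1=1$, $\psi_2=2y+a_1x+a_3$, $\psi_3=3x^4+b_2x^3+3b_4x^2+3b_6x+b_8$, $\psi_4=\psi_2\cdot(2x^6+b_2x^5+5b_4x^4+10b_6x^3+10b_8x^2+(b_2b_8-b_4b_6)x+b_4b_8-b_6^2)$, $\psi_{2m+1}=\psi_{m+2}\psi_m^3-\psi_{m-1}\psi_{m+1}^3$ for $m\ge 2$, and $\psi_{2m}\psi_2=\psi_m(\psi_{m-1}^2\psi_{m+2}-\psi_{m-2}\psi_{m+1}^2)$ for $m\ge 3$, with $b_2=a_1^2+4a_2$, $b_4=2a_4+a_1a_3$, $b_6=a_3^2+4a_6$, $b_8=a_1^2a_6+4a_2a_6-a_1a_3a_4+a_2a_3^2-a_4^2$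 (the quotient by $\psi_2$ is the one given by the universal polynomial identity, so that $F_n$ makes sense in every characteristic). Equivalently, for $n\ge 1$, $F_n$ is the rational function on $E$ with divisor $[n]^*(\mathcal{O})-n^2(\mathcal{O})$ for which $z^{n^2}F_n/[n](z)$ takes the value $1$ at $\mathcal{O}$, where $[n](z)$ is the multiplication-by-$n$ series of the formal group of $E$. Then there are units $a,b\in\mathbb{F}^*$, depending on $P$, such that: (a) If $r\ge 3$, then $F_{kr+n}(P)=a^{kn}\,b^{k^2}\,F_n(P)$ for all integers $k,n\ge 0$. (b) If $r=2$, then $F_{2k}(P)=0$ and $F_{2k+1}(P)=a^k\,b^{(k^2-k)/2}$ for all integers $k\ge 0$. -/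

import Mathlib

open Polynomial

/-- The `n`-division polynomial `F_n ∈ R[X, Y]` of a Weierstrass curve, normalized relative to the
uniformizer `z = -x/y` at the point at infinity.

Mathlib's `W.ψ n` is the classical division polynomial, with `ψ₂ = 2Y + a₁X + a₃`. Near infinity
`x` has leading term `z⁻²` and `y` has leading term `-z⁻³`, so that `ψₙ` has leading term
`(-1) ^ (n + 1) * n * z ^ (1 - n ^ 2)`. The sign below makes the leading term of `F_n` equal to
`n * z ^ (1 - n ^ 2)`, in other words it makes `z ^ (n ^ 2) * F_n / [n](z)` take the value `1` at
infinity. By convention `F_0 = 0`. -/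
noncomputable def WeierstrassCurve.divisionPoly {R : Type*} [CommRing R] (W : WeierstrassCurve R)
    (n : ℕ) : R[X][X] :=
  (-1) ^ (n + 1) * W.ψ (n : ℤ)

/-! Write `W n` for the value ψₙ(P). If `W 2 ≠ 0`, the doubling recurrences make `W` an elliptic net
(`IsEllipticNet.normEDS`), and ψ₄ + ψ₂⁵ = (6x² + b₂x + b₄)ψ₂ψ₃ on the curve, so a Somos invariant is
available (`invariant`). The invariant is also what the addition law yields for the abscissas of (Q
± P), so x(nP) - x(P) = -ψₙ₊₁ψₙ₋₁/ψₙ² holds by induction below the order (`x_nsmul`). Hence for `r ≥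
3` the first positive zero of `W` is at `r`.

At such a zero, the invariant and the net relations force `W (r + n) = A ^ n * B * W n`
(`exists_apply_add`). A further relation gives `A ^ r = B ^ 2`, and iterating yields the factor `A ^
(k * n) * B ^ (k ^ 2)`; the signs of F_n are absorbed into `b`.

For `r = 2` all even terms vanish, one term of the odd recurrence survives, and everything is a
signed power of ψ₃(P), nonzero by nonsingularity. -/

namespace IsEllipticNet

/-! ### From the doubling recurrences to the full net relations. -/

section net

variable {R : Type*} [CommRing R] {W : ℤ → R}

/-- A sequence whose atoms satisfy the relations with a fixed pair `(c₀, d₀)` as last two entries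
satisfies the Plücker relation. -/
lemma atomRel_mul_sq_of_base {a b c d c₀ d₀ : ℤ}
    (hab : atomRel W a b c₀ d₀ = 0) (hac : atomRel W a c c₀ d₀ = 0)
    (had : atomRel W a d c₀ d₀ = 0) (hbc : atomRel W b c c₀ d₀ = 0)
    (hbd : atomRel W b d c₀ d₀ = 0) (hcd : atomRel W c d c₀ d₀ = 0) :
    atom W c₀ d₀ ^ 2 * atomRel W a b c d = 0 := by
  simp only [atomRel] at *
  linear_combination (atom W c d * atom W c₀ d₀) * hab - (atom W b d * atom W c₀ d₀) * hac
    + (atom W b c * atom W c₀ d₀) * had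
    + (atom W a c₀ * atom W b d₀ - atom W a d₀ * atom W b c₀) * hcd
    - (atom W a c₀ * atom W c d₀ - atom W a d₀ * atom W c c₀) * hbd
    + (atom W a c₀ * atom W d d₀ - atom W a d₀ * atom W d c₀) * hbc

lemma atomRel_swap₁₂ (odd : W.Odd) (a b c d : ℤ) : atomRel W b a c d = -atomRel W a b c d := by
  simp only [atomRel, ← neg_atom odd a b]
  ring

lemma atomRel_base_of_forall_lt (odd : W.Odd) (zero : W 0 = 0) {N e : ℤ}
    (base : ∀ a b : ℤ, a % 2 = e → b % 2 = e → 0 ≤ b → b < a → a < N →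
      atomRel W a b (2 + e) e = 0)
    (a b : ℤ) (ha : a % 2 = e) (hb : b % 2 = e) (haN : |a| < N) (hbN : |b| < N) :
    atomRel W a b (2 + e) e = 0 := by
  rw [← atomRel_abs₁ odd, ← atomRel_abs₂ odd]
  have ha' : |a| % 2 = e := by rcases abs_choice a with h | h <;> rw [h] <;> omega
  have hb' : |b| % 2 = e := by rcases abs_choice b with h | h <;> rw [h] <;> omega
  rcases lt_trichotomy |a| |b| with h | h | h
  · rw [atomRel_swap₁₂ odd, base _ _ hb' ha' (abs_nonneg _) h hbN, neg_zero]
  · rw [h, atomRel_same₁₂, zero, mul_zero, zero_mul]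
  · exact base _ _ ha' hb' (abs_nonneg _) h haN

variable [IsDomain R]

lemma atomRel_eq_zero_of_forall_lt (odd : W.Odd) (zero : W 0 = 0) (one : W 1 = 1) (two : W 2 ≠ 0)
    {N e : ℤ} (he : e = 0 ∨ e = 1)
    (base : ∀ a b : ℤ, a % 2 = e → b % 2 = e → 0 ≤ b → b < a → a < N →
      atomRel W a b (2 + e) e = 0)
    (a b c d : ℤ) (ha : a % 2 = e) (hb : b % 2 = e) (hc : c % 2 = e) (hd : d % 2 = e)
    (haN : |a| < N) (hbN : |b| < N) (hcN : |c| < N) (hdN : |d| < N) :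
    atomRel W a b c d = 0 := by
  have key := atomRel_base_of_forall_lt odd zero base
  -- The base atom is `1` for `e = 0` and `W 2` for `e = 1`, whence the need for `W 2 ≠ 0`.
  have h0 : atom W (2 + e) e ≠ 0 := by
    rcases he with rfl | rfl
    · have := atom_even W 1 0
      norm_num [one] at this ⊢
      simp [this]
    · have := atom_odd W 1 0
      norm_num [one] at this ⊢
      simp [this, two]
  exact (mul_eq_zero.mp (atomRel_mul_sq_of_base (key a b ha hb haN hbN) (key a c ha hc haN hcN)
    (key a d ha hd haN hdN) (key b c hb hc hbN hcN) (key b d hb hd hbN hdN)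
    (key c d hc hd hcN hdN))).resolve_left (pow_ne_zero 2 h0)

/-- Induction on the largest entry. If `b = a - 2` the relation is a doubling recurrence. Otherwise,
apart from degenerate cases, replacing each entry by half the total sum minus that entry makes all
entries smaller. This may change their parity, so both values of `e` are treated together. -/
lemma atomRel_base (odd : W.Odd) (zero : W 0 = 0) (one : W 1 = 1) (two : W 2 ≠ 0)
    (even_rec : ∀ m, rel W (m + 1) (m - 1) 1 0 = 0) (odd_rec : ∀ m, rel W (m + 1) m 1 0 = 0)
    (N : ℕ) : ∀ e : ℤ, e = 0 ∨ e = 1 → ∀ a b : ℤ, a % 2 = e → b % 2 = e → 0 ≤ b → b < a →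
      a < N → atomRel W a b (2 + e) e = 0 := by
  induction N with
  | zero => intro e _ a b _ _ h0 h1 h2; push_cast at h2; omega
  | succ N ih =>
    intro e he a b ha hb hb0 hba haN
    rcases lt_or_ge a N with h | h
    · exact ih e he a b ha hb hb0 hba h
    rcases eq_or_ne b e with rfl | hbe
    · rw [atomRel_same₂₄ odd, zero, mul_zero, zero_mul]
    rcases eq_or_ne b (2 + e) with rfl | hbe'
    · rw [atomRel_same₂₃, zero, mul_zero, zero_mul]
    rcases eq_or_ne b (a - 2) with rfl | hba'
    · rcases he with rfl | rfl
      · obtain ⟨m, rfl⟩ : ∃ m, a = 2 * m := ⟨a / 2, by omega⟩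
        have := atomRel_two_mul W m (m - 1) 1 0
        have h2 := odd_rec (m - 1)
        simp only [sub_zero, mul_zero, mul_one] at this
        rw [sub_add_cancel] at h2
        rw [show 2 * m - 2 = 2 * (m - 1) by ring, add_zero, this, h2]
      · obtain ⟨m, rfl⟩ : ∃ m, a = 2 * m + 1 := ⟨a / 2, by omega⟩
        have h1 := rel_eq W m (m - 1) 1 1
        have h2 := even_rec m
        rw [rel_even, one] at h2
        rw [show 2 * m + 1 - 2 = 2 * (m - 1) + 1 by ring, show (2 + 1 : ℤ) = 2 * 1 + 1 by ring,
          ← h1, rel]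
        ring_nf at h2 ⊢
        rw [one]
        linear_combination h2
    -- The largest new entry is `(a + b + 2) / 2 ≤ a - 1`.
    · have hab : b ≤ a - 4 := by omega
      have hb4 : 4 + e ≤ b := by omega
      rw [← atomRel_avg_sub W (by omega)]
      have habs {x : ℤ} (h1 : x < N) (h2 : -x < N) : |x| < (N : ℤ) := abs_lt.mpr ⟨by omega, h1⟩
      obtain ⟨s, hs⟩ : ∃ s, a + b + (2 + e) + e = 2 * s := ⟨(a + b + (2 + e) + e) / 2, by omega⟩
      rw [hs, Int.mul_ediv_cancel_left _ two_ne_zero]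
      have he' := Int.emod_two_eq_zero_or_one (s - e)
      push_cast at haN
      exact atomRel_eq_zero_of_forall_lt odd zero one two he' (ih _ he') _ _ _ _ rfl
        (by omega) (by omega) (by omega) (habs (by omega) (by omega)) (habs (by omega) (by omega))
        (habs (by omega) (by omega)) (habs (by omega) (by omega))

theorem isEllipticNet_of_rel (odd : W.Odd) (zero : W 0 = 0) (one : W 1 = 1) (two : W 2 ≠ 0)
    (even_rec : ∀ m, rel W (m + 1) (m - 1) 1 0 = 0) (odd_rec : ∀ m, rel W (m + 1) m 1 0 = 0) :
    IsEllipticNet W := by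
  intro p q r s
  rw [rel_eq]
  have he := Int.emod_two_eq_zero_or_one s
  obtain ⟨N, hN⟩ : ∃ N : ℕ, (N : ℤ) = |2 * p + s| + |2 * q + s| + |2 * r + s| + |s| + 1 :=
    ⟨_, Int.toNat_of_nonneg (by positivity)⟩
  have h1 := abs_nonneg (2 * p + s)
  have h2 := abs_nonneg (2 * q + s)
  have h3 := abs_nonneg (2 * r + s)
  have h4 := abs_nonneg s
  exact atomRel_eq_zero_of_forall_lt odd zero one two he
    (atomRel_base odd zero one two even_rec odd_rec N _ he) _ _ _ _ (by omega) (by omega)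
    (by omega) rfl (by omega) (by omega) (by omega) (by omega)

end net

section normEDS

variable {R : Type*} [CommRing R] [IsDomain R]

theorem normEDS {b : R} (c d : R) (hb : b ≠ 0) : IsEllipticNet (normEDS b c d) := by
  refine isEllipticNet_of_rel (fun n ↦ normEDS_neg b c d n) (normEDS_zero ..) (normEDS_one ..)
    (by rwa [normEDS_two]) (fun m ↦ ?_) (fun m ↦ ?_)
  · rw [rel_even, normEDS_one, normEDS_two, one_pow, mul_one, normEDS_even]
    ring
  · rw [rel_odd, normEDS_one, one_pow, mul_one, normEDS_odd]
    ring

end normEDS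

end IsEllipticNet

/-! ### Translating a net by its first positive zero. -/

namespace IsEllipticNet

section field

variable {K : Type*} [Field K] {W : ℤ → K}

lemma add_mul_sub (net : IsEllipticNet W) (one : W 1 = 1) (m n : ℤ) :
    W (m + n) * W (m - n) =
      W (m + 1) * W (m - 1) * W n ^ 2 - W (n + 1) * W (n - 1) * W m ^ 2 := by
  have h := net m n 1 0
  simp only [rel, add_zero, one] at h
  linear_combination h

lemma add_two_mul_sub_two (net : IsEllipticNet W) (one : W 1 = 1) (m : ℤ) :
    W (m + 2) * W (m - 2) = W (m + 1) * W (m - 1) * W 2 ^ 2 - W 3 * W m ^ 2 := by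
  have h := net.add_mul_sub one m 2
  norm_num [one] at h
  exact h

/-- The Somos invariant: the ratio of the left-hand side by `W (n - 1) * W n * W (n + 1)` does not
depend on `n`. -/
lemma invariant (net : IsEllipticNet W) (zero : W 0 = 0) (one : W 1 = 1) {i : K}
    (hi : i * W 2 * W 3 = W 4 + W 2 ^ 5) (n : ℕ)
    (hn : ∀ k : ℕ, 0 < k → k ≤ n → W k ≠ 0) :
    W (n + 4) * W (n + 1) ^ 2 + W n * W (n + 3) ^ 2 + W 2 ^ 2 * W (n + 2) ^ 3 =
      i * W (n + 1) * W (n + 2) * W (n + 3) := by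
  induction n with
  | zero =>
    norm_num [zero, one]
    linear_combination -hi
  | succ n ih =>
    have ih := ih fun k h0 hk ↦ hn k h0 (by omega)
    have h0 := hn (n + 1) (by omega) le_rfl
    have h3 := net.add_two_mul_sub_two one (n + 3)
    have h2 := net.add_two_mul_sub_two one (n + 2)
    push_cast at h0 ⊢
    apply mul_right_cancel₀ h0
    ring_nf at h0 ih h2 h3 ⊢
    linear_combination W (4 + n) * ih + W (2 + n) ^ 2 * h3 - W (3 + n) ^ 2 * h2

/-- For `r = 3`, two consecutive zeros would give `W 2 ^ 5 = 0` by `hi`; for `r ≥ 4` they would give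
`W 3 * W (r - 1) ^ 2 = 0`. -/
lemma ne_zero_of_eq_zero (net : IsEllipticNet W) (one : W 1 = 1) {i : K}
    (hi : i * W 2 * W 3 = W 4 + W 2 ^ 5) {r : ℕ} (hr : 3 ≤ r)
    (ne : ∀ k : ℕ, 0 < k → k < r → W k ≠ 0) (hW : W r = 0) : W (r + 1) ≠ 0 := by
  intro h
  obtain rfl | hr := hr.eq_or_lt
  · have h2 := ne 2 (by omega) (by omega)
    norm_num at h hW h2
    rw [h, hW, mul_zero, zero_add] at hi
    exact pow_ne_zero 5 h2 hi.symm
  · have h3 := ne 3 (by omega) hr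
    have h1 := ne (r - 1) (by omega) (by omega)
    have h' := net.add_two_mul_sub_two one (r - 1)
    rw [Nat.cast_sub (by omega)] at h1
    push_cast at h1 h3
    rw [show (r : ℤ) - 1 + 2 = r + 1 by ring, sub_add_cancel, h, hW] at h'
    simp [h1, h3] at h'

/-- A net that vanishes at `r` is multiplied by a geometric progression when translated by `r`. -/
lemma exists_apply_add (net : IsEllipticNet W) (zero : W 0 = 0) (one : W 1 = 1) {i : K}
    (hi : i * W 2 * W 3 = W 4 + W 2 ^ 5) {r : ℕ} (hr : 3 ≤ r)
    (ne : ∀ k : ℕ, 0 < k → k < r → W k ≠ 0) (hW : W r = 0) :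
    ∃ A B : K, A ≠ 0 ∧ B ≠ 0 ∧ A * W (r - 1) = -B ∧ ∀ n : ℕ, W (r + n) = A ^ n * B * W n := by
  have h1 := net.ne_zero_of_eq_zero one hi hr ne hW
  have h2 : W 2 ≠ 0 := ne 2 (by omega) (by omega)
  have hm1 : W (r - 1) ≠ 0 := by
    have := ne (r - 1) (by omega) (by omega)
    rwa [Nat.cast_sub (by omega), Nat.cast_one] at this
  have hm2 : W (r - 2) ≠ 0 := by
    have := ne (r - 2) (by omega) (by omega)
    rwa [Nat.cast_sub (by omega), Nat.cast_ofNat] at this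
  have s0 : W (r + 2) * W (r - 2) = W (r + 1) * W (r - 1) * W 2 ^ 2 := by
    rw [net.add_two_mul_sub_two one, hW]; ring
  have hp2 : W (r + 2) ≠ 0 := by
    intro h
    rw [h, zero_mul] at s0
    exact mul_ne_zero (mul_ne_zero h1 hm1) (pow_ne_zero 2 h2) s0.symm
  -- The invariant centred at `r`, where two of its terms vanish.
  have inv : W (r + 2) * W (r - 1) ^ 2 + W (r - 2) * W (r + 1) ^ 2 = 0 := by
    have := net.invariant zero one hi (r - 2) fun k h0 hk ↦ ne k h0 (by omega)
    rw [Nat.cast_sub (by omega)] at this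
    push_cast at this
    ring_nf at this hW ⊢
    rw [hW] at this
    linear_combination this
  have key : W (r - 1) * W (r + 2) ^ 2 = -(W 2 ^ 2 * W (r + 1) ^ 3) := by
    apply mul_right_cancel₀ hm1
    linear_combination W (r + 2) * inv - W (r + 1) ^ 2 * s0
  have s1 : W (r + 3) * W (r - 1) = -(W 3 * W (r + 1) ^ 2) := by
    have := net.add_two_mul_sub_two one (r + 1)
    ring_nf at this hW ⊢
    rw [hW] at this
    linear_combination this
  have s2 : W (r + 4) * W (r - 2) = -(W 4 * W 2 * W (r + 1) ^ 2) := by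
    have := net.add_mul_sub one (r + 1) 3
    ring_nf at this hW ⊢
    rw [hW] at this
    linear_combination this
  -- `A` and `B` are dictated by the cases `n = 1` and `n = 2`; `hm` and `hm2'` are then the cases
  -- `n = -1` and `n = -2`.
  obtain ⟨A, hA⟩ : ∃ A, W (r + 2) = A * W 2 * W (r + 1) :=
    ⟨W (r + 2) / (W 2 * W (r + 1)), by field_simp⟩
  have hA0 : A ≠ 0 := by rintro rfl; simp [hA] at hp2
  obtain ⟨B, hB⟩ : ∃ B, W (r + 1) = A * B := ⟨W (r + 1) / A, by field_simp⟩
  have hB0 : B ≠ 0 := by rintro rfl; simp [hB] at h1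
  have hm : A * W (r - 1) = -B := by
    rw [hA, hB] at key
    have : A ^ 3 * B ^ 2 * W 2 ^ 2 ≠ 0 := by positivity
    apply mul_left_cancel₀ this
    linear_combination key
  refine ⟨A, B, hA0, hB0, hm, fun n ↦ ?_⟩
  have hm2' : A ^ 2 * W (r - 2) = -(B * W 2) := by
    rw [hA, hB] at s0
    apply mul_left_cancel₀ (show A * B * W 2 ≠ 0 by positivity)
    linear_combination A * s0 + A * B * W 2 ^ 2 * hm
  induction n using normEDSRec' with
  | zero => simp [hW, zero]
  | one => simp [hB, one]
  | two => push_cast; rw [hA, hB]; ring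
  | three =>
    push_cast
    rw [hB] at s1
    apply mul_left_cancel₀ hB0
    linear_combination W (r + 3) * hm - A * s1
  | four =>
    push_cast
    rw [hB] at s2
    apply mul_left_cancel₀ (show B * W 2 ≠ 0 by positivity)
    linear_combination W (r + 4) * hm2' - A ^ 2 * s2
  | even m ih =>
    -- With last argument `r` instead of `0`, each product acquires exactly two shifted factors, so
    -- the two relations differ by a common power of `A` times `B ^ 2`.
    have e0 := net (m + 4) (m + 2) 1 0
    have er := net (m + 4) (m + 2) 1 r
    have i1 := ih (m + 2) (by omega)
    have i2 := ih (m + 3) (by omega)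
    have i3 := ih (m + 4) (by omega)
    have i4 := ih (m + 5) (by omega)
    rw [rel] at e0 er
    push_cast at i1 i2 i3 i4 ⊢
    apply mul_right_cancel₀ (show W 2 * (A * B) ≠ 0 by positivity)
    ring_nf at e0 er i1 i2 i3 i4 hB one ⊢
    rw [i1, i2, i3, i4, hB] at er
    simp only [one] at e0 er
    linear_combination er - A ^ (7 + 2 * m) * B ^ 2 * e0
  | odd m ih =>
    have e0 := net (m + 3) (m + 2) 1 0
    have er := net (m + 3) (m + 2) 1 r
    have i1 := ih (m + 2) (by omega)
    have i2 := ih (m + 3) (by omega)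
    have i3 := ih (m + 4) (by omega)
    rw [rel] at e0 er
    push_cast at i1 i2 i3 ⊢
    apply mul_right_cancel₀ (show A * B ≠ 0 by positivity)
    ring_nf at e0 er i1 i2 i3 hB one ⊢
    rw [i1, i2, i3, hB, one] at er
    rw [one] at e0
    linear_combination er - A ^ (6 + 2 * m) * B ^ 2 * e0

theorem exists_apply_mul_add (net : IsEllipticNet W) (zero : W 0 = 0) (one : W 1 = 1) {i : K}
    (hi : i * W 2 * W 3 = W 4 + W 2 ^ 5) {r : ℕ} (hr : 3 ≤ r)
    (ne : ∀ k : ℕ, 0 < k → k < r → W k ≠ 0) (hW : W r = 0) :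
    ∃ A B : K, A ≠ 0 ∧ B ≠ 0 ∧
      ∀ k n : ℕ, W ((k * r + n : ℕ) : ℤ) = A ^ (k * n) * B ^ (k ^ 2) * W n := by
  obtain ⟨A, B, hA, hB, hm, h⟩ := net.exists_apply_add zero one hi hr ne hW
  -- Since `W r = 0`, the relation for `W (2 * r - 1)` reads `W (2 * r - 1) = W (r + 1) * W (r - 1)
  -- ^ 3`; both sides are known from the translation formula.
  have hAB : A ^ r = B ^ 2 := by
    obtain ⟨s, rfl⟩ : ∃ s, r = s + 1 := ⟨r - 1, by omega⟩
    have e := net.add_mul_sub one (s + 1 : ℕ) s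
    have h1 := h 1
    have h2 := h s
    have hs := ne s (by omega) (by omega)
    push_cast at *
    rw [hW, h1, h2] at e
    ring_nf at e hm one
    rw [one] at e
    apply mul_right_cancel₀ hB
    apply mul_right_cancel₀ hs
    have hm' : A ^ 2 * W s ^ 2 = B ^ 2 := by rw [← mul_pow, hm, neg_sq]
    linear_combination A * e + B * W s * hm'
  refine ⟨A, B, hA, hB, fun k ↦ ?_⟩
  induction k with
  | zero => simp
  | succ k ih =>
    intro n
    have h1 := h (k * r + n)
    rw [ih n] at h1
    rw [show (k + 1) * r + n = r + (k * r + n) by ring, Nat.cast_add, h1, pow_add A, mul_comm k r,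
      pow_mul A, hAB]
    ring

end field
end IsEllipticNet

/-! ### Values of division polynomials at an affine point. -/

namespace WeierstrassCurve

section divisionValue

variable {F : Type*} [Field F] (E : WeierstrassCurve F) (x y : F)

/-- The value at an affine point of the `n`-th division polynomial. -/
noncomputable def divisionValue (n : ℤ) : F :=
  (E.ψ n).evalEval x y

lemma divisionValue_eq_normEDS : E.divisionValue x y =
    normEDS (E.ψ₂.evalEval x y) (E.Ψ₃.eval x) (E.preΨ₄.eval x) := by
  funext n
  rw [divisionValue, ← coe_evalEvalRingHom, WeierstrassCurve.ψ, map_normEDS]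
  simp

lemma evalEval_ψ₂ : E.ψ₂.evalEval x y = 2 * y + E.a₁ * x + E.a₃ := by
  rw [ψ₂, Affine.evalEval_polynomialY]

lemma evalEval_divisionPoly (n : ℕ) :
    (E.divisionPoly n).evalEval x y = (-1) ^ (n + 1) * E.divisionValue x y n := by
  rw [divisionPoly, divisionValue, ← coe_evalEvalRingHom]
  simp

variable {x y}

lemma divisionValue_two_sq (h : E.toAffine.Equation x y) :
    E.divisionValue x y 2 ^ 2 = 4 * x ^ 3 + E.b₂ * x ^ 2 + 2 * E.b₄ * x + E.b₆ := by
  rw [divisionValue_eq_normEDS, normEDS_two, evalEval_ψ₂]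
  rw [Affine.equation_iff] at h
  simp only [b₂, b₄, b₆]
  linear_combination 4 * h

/-- The induction step of `x_nsmul`: `v`, `u`, `w` are the abscissas of three consecutive multiples
of P minus x(P), and `o`, `p`, `q`, `s`, `t` are five consecutive values of ψ. -/
lemma sub_mul_sq_of_invariant {u v w o p q s t S I : F} (hu : u * q ^ 2 = -(s * p))
    (hv : v * p ^ 2 = -(q * o)) (hw : (w + v) * u ^ 2 = S + I * u)
    (inv : t * p ^ 2 + o * s ^ 2 + S * q ^ 3 = I * p * q * s) (hp : p ≠ 0) :
    w * s ^ 2 = -(t * q) := by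
  apply mul_right_cancel₀ (pow_ne_zero 2 hp)
  linear_combination q ^ 4 * hw - ((w + v) * (u * q ^ 2 - s * p) - I * q ^ 2) * hu - s ^ 2 * hv
    + q * inv

lemma divisionValue_invariant (h : E.toAffine.Equation x y) :
    (6 * x ^ 2 + E.b₂ * x + E.b₄) * E.divisionValue x y 2 * E.divisionValue x y 3 =
      E.divisionValue x y 4 + E.divisionValue x y 2 ^ 5 := by
  have hb := E.divisionValue_two_sq h
  rw [divisionValue_eq_normEDS, normEDS_two, evalEval_ψ₂] at hb
  rw [divisionValue_eq_normEDS, normEDS_two, normEDS_three, normEDS_four, evalEval_ψ₂]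
  simp only [Ψ₃, preΨ₄, eval_add, eval_mul, eval_pow, eval_X, eval_C, eval_ofNat]
  linear_combination -(2 * y + E.a₁ * x + E.a₃) * ((2 * y + E.a₁ * x + E.a₃) ^ 2
    + (4 * x ^ 3 + E.b₂ * x ^ 2 + 2 * E.b₄ * x + E.b₆)) * hb
    - (2 * y + E.a₁ * x + E.a₃) * x ^ 2 * E.b_relation

/-- This form of ψ₃ exhibits the numerator of the tangent slope: it gives the duplication formula
directly, and at a 2-torsion point it leaves minus the square of that numerator. -/
lemma divisionValue_three (h : E.toAffine.Equation x y) :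
    E.divisionValue x y 3 = (3 * x + E.a₂) * E.divisionValue x y 2 ^ 2
      - E.a₁ * (3 * x ^ 2 + 2 * E.a₂ * x + E.a₄ - E.a₁ * y) * E.divisionValue x y 2
      - (3 * x ^ 2 + 2 * E.a₂ * x + E.a₄ - E.a₁ * y) ^ 2 := by
  rw [divisionValue_eq_normEDS, normEDS_two, normEDS_three, evalEval_ψ₂]
  rw [Affine.equation_iff] at h
  simp only [Ψ₃, eval_add, eval_mul, eval_pow, eval_X, eval_C, eval_ofNat, b₂, b₄, b₆, b₈]
  linear_combination -(12 * x + 4 * E.a₂ + E.a₁ ^ 2) * h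

lemma divisionValue_three_ne_zero (h : E.toAffine.Nonsingular x y)
    (h2 : E.divisionValue x y 2 = 0) : E.divisionValue x y 3 ≠ 0 := by
  rw [E.divisionValue_three h.1, h2]
  rw [divisionValue_eq_normEDS, normEDS_two, evalEval_ψ₂] at h2
  rw [Affine.nonsingular_iff] at h
  have h' := h.2.resolve_right fun h ↦ h (by linear_combination h2)
  have : 3 * x ^ 2 + 2 * E.a₂ * x + E.a₄ - E.a₁ * y ≠ 0 := fun h0 ↦ h' (by linear_combination -h0)
  simpa using this

lemma _root_.Nat.two_mul_sq_sub_self_div_two_add (k : ℕ) : 2 * ((k ^ 2 - k) / 2) + k = k ^ 2 := by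
  have h1 : k ≤ k ^ 2 := Nat.le_self_pow two_ne_zero k
  have h2 : Even (k ^ 2 - k) := by
    rw [Nat.even_sub h1]
    simp [Nat.even_pow]
  have := Nat.two_mul_div_two_of_even h2
  omega

/-- The values at a point of order two. -/
lemma divisionValue_of_two_eq_zero (h2 : E.divisionValue x y 2 = 0) (k : ℕ) :
    E.divisionValue x y (2 * k) = 0 ∧ E.divisionValue x y (2 * k + 1) =
      E.divisionValue x y 3 ^ k * (-E.divisionValue x y 3) ^ ((k ^ 2 - k) / 2) := by
  have even (m : ℤ) : E.divisionValue x y (2 * m) = 0 := by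
    rw [divisionValue_eq_normEDS, normEDS_two] at h2
    simp [divisionValue_eq_normEDS, normEDS, h2]
  have odd_rec (m : ℤ) : E.divisionValue x y (2 * m + 1) =
      E.divisionValue x y (m + 2) * E.divisionValue x y m ^ 3 -
        E.divisionValue x y (m - 1) * E.divisionValue x y (m + 1) ^ 3 := by
    simp only [divisionValue_eq_normEDS, normEDS_odd]
  refine ⟨even k, ?_⟩
  induction k using Nat.strong_induction_on with
  | _ k ih =>
    have e (j : ℕ) := Nat.two_mul_sq_sub_self_div_two_add j
    obtain ⟨j, hj⟩ := Nat.even_or_odd' k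
    rcases hj with rfl | rfl
    · rcases j with _ | i
      · simp [divisionValue_eq_normEDS]
      · have h1 := ih i (by omega)
        have h2 := ih (i + 1) (by omega)
        -- All the exponents are expressed linearly in one triangular number `t` and `i`, which
        -- removes the truncated division.
        obtain ⟨t, ht⟩ : ∃ t, (i ^ 2 - i) / 2 = t := ⟨_, rfl⟩
        have e0 := e i
        have e1 : ((i + 1) ^ 2 - (i + 1)) / 2 = t + i := by
          have := e (i + 1)
          ring_nf at this e0 ⊢
          omega
        have e2 : ((2 * (i + 1)) ^ 2 - 2 * (i + 1)) / 2 = 4 * t + 3 * i + (2 * i + 1) := by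
          have := e (2 * (i + 1))
          ring_nf at this e0 ⊢
          omega
        have hc := odd_rec (2 * (i + 1))
        rw [show (2 * (i + 1) + 2 : ℤ) = 2 * (i + 2) by ring, even, even,
          show (2 * (i + 1) - 1 : ℤ) = 2 * i + 1 by ring, h1] at hc
        push_cast at h2 ⊢
        rw [h2, ht, e1] at hc
        rw [hc, e2, pow_add _ (4 * t + 3 * i), (odd_two_mul_add_one i).neg_pow]
        ring
    · rcases j with _ | i
      · simp
      · have h1 := ih (i + 1) (by omega)
        have h2 := ih (i + 2) (by omega)
        obtain ⟨t, ht⟩ : ∃ t, ((i + 1) ^ 2 - (i + 1)) / 2 = t := ⟨_, rfl⟩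
        have e0 := e (i + 1)
        have e1 : ((i + 2) ^ 2 - (i + 2)) / 2 = t + (i + 1) := by
          have := e (i + 2)
          ring_nf at this e0 ht ⊢
          omega
        have e2 : ((2 * (i + 1) + 1) ^ 2 - (2 * (i + 1) + 1)) / 2 =
            4 * t + (i + 1) + 2 * (i + 1) := by
          have := e (2 * (i + 1) + 1)
          ring_nf at this e0 ht ⊢
          omega
        have hc := odd_rec (2 * (i + 1) + 1)
        rw [show (2 * (i + 1) + 1 + 2 : ℤ) = 2 * (i + 2) + 1 by ring,
          show (2 * (i + 1) + 1 + 1 : ℤ) = 2 * (i + 2) by ring, even] at hc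
        push_cast at h1 h2 ⊢
        rw [h1, h2, ht, e1] at hc
        rw [hc, e2, pow_add _ (4 * t + (i + 1)), (even_two_mul (i + 1)).neg_pow]
        ring

end divisionValue

/-! ### Abscissas of multiples of a point. -/

section multiples

variable {F : Type*} [Field F] [DecidableEq F] (E : WeierstrassCurve F) {x y : F}

open WeierstrassCurve.Affine

/-- Summing over (Q ± P) eliminates the ordinates. Expanded around x₂ = x(P), the right side
produces the coefficients ψ₂² and 6x² + b₂x + b₄ of the Somos invariant. -/
lemma addX_add_addX_negY {x₁ x₂ y₁ y₂ : F} (h₁ : E.toAffine.Equation x₁ y₁)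
    (h₂ : E.toAffine.Equation x₂ y₂) (hx : x₁ ≠ x₂) :
    (E.toAffine.addX x₁ x₂ (E.toAffine.slope x₁ x₂ y₁ y₂) +
      E.toAffine.addX x₁ x₂ (E.toAffine.slope x₁ x₂ y₁ (E.toAffine.negY x₂ y₂))) *
        (x₁ - x₂) ^ 2 =
      2 * x₁ * x₂ * (x₁ + x₂) + E.b₂ * x₁ * x₂ + E.b₄ * (x₁ + x₂) + E.b₆ := by
  rw [equation_iff] at h₁ h₂
  have hd : x₁ - x₂ ≠ 0 := sub_ne_zero.mpr hx
  simp only [slope_of_X_ne hx, addX, negY, b₂, b₄, b₆]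
  field_simp
  linear_combination 2 * h₁ + 2 * h₂

lemma x_nsmul_two (hP : E.toAffine.Nonsingular x y) (h2 : E.divisionValue x y 2 ≠ 0) :
    ∃ x' y', ∃ h' : E.toAffine.Nonsingular x' y', 2 • Point.some x y hP = Point.some x' y' h' ∧
      (x' - x) * E.divisionValue x y 2 ^ 2 = - E.divisionValue x y 3 := by
  have e2 : E.divisionValue x y 2 = y - E.toAffine.negY x y := by
    rw [divisionValue_eq_normEDS, normEDS_two, evalEval_ψ₂, negY]
    ring
  have hy : y ≠ E.toAffine.negY x y := sub_ne_zero.mp (e2 ▸ h2)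
  refine ⟨_, _, _, (two_nsmul _).trans (Point.add_self_of_Y_ne hy), ?_⟩
  rw [slope_of_Y_ne rfl hy, ← e2, divisionValue_three E hP.1, addX]
  field_simp
  ring

/-- The first coordinate of the multiples of a point, below its order. -/
lemma x_nsmul (hP : E.toAffine.Nonsingular x y) (h2 : E.divisionValue x y 2 ≠ 0) (n : ℕ)
    (hn : ∀ k : ℕ, 0 < k → k ≤ n + 2 → k • Point.some x y hP ≠ 0) :
    (∀ k : ℕ, 0 < k → k ≤ n + 2 → E.divisionValue x y k ≠ 0) ∧
    (∃ x' y', ∃ h' : E.toAffine.Nonsingular x' y',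
      (n + 1) • Point.some x y hP = Point.some x' y' h' ∧
      (x' - x) * E.divisionValue x y (n + 1) ^ 2 =
        -(E.divisionValue x y (n + 2) * E.divisionValue x y n)) ∧
    (∃ x' y', ∃ h' : E.toAffine.Nonsingular x' y',
      (n + 2) • Point.some x y hP = Point.some x' y' h' ∧
      (x' - x) * E.divisionValue x y (n + 2) ^ 2 =
        -(E.divisionValue x y (n + 3) * E.divisionValue x y (n + 1))) := by
  have zero : E.divisionValue x y 0 = 0 := by simp [divisionValue_eq_normEDS]
  have one : E.divisionValue x y 1 = 1 := by simp [divisionValue_eq_normEDS]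
  have net : IsEllipticNet (E.divisionValue x y) := by
    rw [divisionValue_eq_normEDS] at h2 ⊢
    exact IsEllipticNet.normEDS _ _ (by simpa using h2)
  induction n with
  | zero =>
    refine ⟨fun k h0 hk ↦ ?_, ⟨x, y, hP, by simp, by simp [zero]⟩, ?_⟩
    · interval_cases k
      · simp [one]
      · exact h2
    · simpa [one] using E.x_nsmul_two hP h2
  | succ n ih =>
    obtain ⟨ne, ⟨x₁, y₁, p₁, e₁, f₁⟩, ⟨x₂, y₂, p₂, e₂, f₂⟩⟩ :=
      ih fun k h0 hk ↦ hn k h0 (by omega)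
    have inv := net.invariant zero one (E.divisionValue_invariant hP.1) n
      fun k h0 hk ↦ ne k h0 (by omega)
    -- Equal abscissas would mean (n + 2)P = ±P, so (n + 1)P or (n + 3)P would be zero.
    have hx : x₂ ≠ x := by
      rintro rfl
      rcases (Point.X_eq_iff (h₁ := p₂) (h₂ := hP)).mp rfl with h | h
      · apply hn (n + 1) (by omega) (by omega)
        rwa [← e₂, succ_nsmul _ (n + 1), add_eq_right] at h
      · apply hn (n + 3) (by omega) le_rfl
        rw [succ_nsmul, e₂, h, neg_add_cancel]
    have h3 : E.divisionValue x y (n + 3) ≠ 0 := by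
      intro h
      rw [h, zero_mul, neg_zero] at f₂
      have := ne (n + 2) (by omega) le_rfl
      push_cast at this
      exact mul_ne_zero (sub_ne_zero.mpr hx) (pow_ne_zero 2 this) f₂
    have ne' : ∀ k : ℕ, 0 < k → k ≤ n + 1 + 2 → E.divisionValue x y k ≠ 0 := by
      intro k h0 hk
      rcases hk.lt_or_eq with hk | rfl
      · exact ne k h0 (by omega)
      · exact_mod_cast h3
    have add : (n + 3) • Point.some x y hP = _ :=
      (succ_nsmul (Point.some x y hP) (n + 2)).trans (e₂ ▸ Point.add_of_X_ne hx)
    have sub : (n + 1) • Point.some x y hP = (n + 2) • Point.some x y hP + - Point.some x y hP := by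
      rw [succ_nsmul _ (n + 1), add_neg_cancel_right]
    rw [e₁, e₂, Point.neg_some, Point.add_of_X_ne hx, Point.some.injEq] at sub
    have sum := E.addX_add_addX_negY p₂.1 hP.1 hx
    rw [← sub.1] at sum
    refine ⟨ne', ⟨x₂, y₂, p₂, e₂, ?_⟩, ⟨_, _, _, add, ?_⟩⟩
    · push_cast
      ring_nf at f₂ ⊢
      exact f₂
    · have h1 := ne (n + 1) (by omega) (by omega)
      push_cast at h1 ⊢
      have := sub_mul_sq_of_invariant (w := E.toAffine.addX x₂ x (E.toAffine.slope x₂ x y₂ y) - x)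
        (t := E.divisionValue x y (n + 4)) (S := E.divisionValue x y 2 ^ 2)
        (I := 6 * x ^ 2 + E.b₂ * x + E.b₄) f₂ f₁
        (by rw [E.divisionValue_two_sq hP.1]; linear_combination sum) (by linear_combination inv) h1
      ring_nf at this ⊢
      exact this

lemma divisionValue_addOrderOf (hP : E.toAffine.Nonsingular x y) {r : ℕ} (hr : 3 ≤ r)
    (hord : addOrderOf (Point.some x y hP) = r) :
    (∀ k : ℕ, 0 < k → k < r → E.divisionValue x y k ≠ 0) ∧ E.divisionValue x y r = 0 := by
  set P := Point.some x y hP with hPdef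
  have hn (k : ℕ) (h0 : 0 < k) (hk : k < r) : k • P ≠ 0 :=
    fun h ↦ (addOrderOf_le_of_nsmul_eq_zero h0 h).not_gt (hord ▸ hk)
  have h2 : E.divisionValue x y 2 ≠ 0 := by
    intro h
    apply hn 2 (by omega) (by omega)
    rw [two_nsmul, hPdef]
    apply Point.add_self_of_Y_eq
    rw [divisionValue_eq_normEDS, normEDS_two, evalEval_ψ₂] at h
    rw [negY]
    linear_combination h
  obtain ⟨n, rfl⟩ : ∃ n, r = n + 3 := ⟨r - 3, by omega⟩
  obtain ⟨ne, -, ⟨x', y', h', e, f⟩⟩ :=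
    E.x_nsmul hP h2 n fun k h0 hk ↦ hn k h0 (by omega)
  refine ⟨fun k h0 hk ↦ ne k h0 (by omega), ?_⟩
  -- As (r - 1)P = -P has the abscissa of P, the formula for x((r - 1)P) forces ψᵣψᵣ₋₂ = 0.
  have h0 : (n + 2) • P = -P := by
    rw [eq_neg_iff_add_eq_zero, ← succ_nsmul]
    exact hord ▸ addOrderOf_nsmul_eq_zero P
  have hx : x' = x := by
    rw [h0, hPdef] at e
    exact Point.X_eq_iff.mpr (Or.inr e.symm)
  have h1 := ne (n + 1) (by omega) (by omega)
  push_cast at h1 ⊢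
  rw [hx, sub_self, zero_mul, eq_comm, neg_eq_zero] at f
  exact (mul_eq_zero.mp f).resolve_right h1

end multiples

end WeierstrassCurve

/-! ### The periodicity theorem. -/

theorem theorem8 {F : Type*} [Field F] [Finite F] [DecidableEq F]
    (E : WeierstrassCurve F) [E.IsElliptic]
    (x y : F) (hP : E.toAffine.Nonsingular x y) (r : ℕ) (hr : 2 ≤ r)
    (hord : addOrderOf (WeierstrassCurve.Affine.Point.some x y hP) = r) :
    ∃ a b : Fˣ,
      (3 ≤ r → ∀ k n : ℕ,
        (E.divisionPoly (k * r + n)).evalEval x y =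
          (a : F) ^ (k * n) * (b : F) ^ (k ^ 2) * (E.divisionPoly n).evalEval x y) ∧
      (r = 2 → ∀ k : ℕ,
        (E.divisionPoly (2 * k)).evalEval x y = 0 ∧
        (E.divisionPoly (2 * k + 1)).evalEval x y =
          (a : F) ^ k * (b : F) ^ ((k ^ 2 - k) / 2)) := by
  have zero : E.divisionValue x y 0 = 0 := by simp [E.divisionValue_eq_normEDS]
  have one : E.divisionValue x y 1 = 1 := by simp [E.divisionValue_eq_normEDS]
  obtain rfl | hr := hr.eq_or_lt
  · have h2 : E.divisionValue x y 2 = 0 := by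
      have h := addOrderOf_nsmul_eq_zero (WeierstrassCurve.Affine.Point.some x y hP)
      rw [hord, two_nsmul, add_eq_zero_iff_eq_neg, WeierstrassCurve.Affine.Point.neg_some,
        WeierstrassCurve.Affine.Point.some.injEq, WeierstrassCurve.Affine.negY] at h
      rw [E.divisionValue_eq_normEDS, normEDS_two, E.evalEval_ψ₂]
      linear_combination h.2
    have h3 := E.divisionValue_three_ne_zero hP h2
    refine ⟨Units.mk0 _ h3, Units.mk0 _ (neg_ne_zero.mpr h3), by omega, fun _ k ↦ ?_⟩
    have h := E.divisionValue_of_two_eq_zero h2 k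
    rw [E.evalEval_divisionPoly, E.evalEval_divisionPoly]
    push_cast
    rw [h.1, h.2, ((even_two_mul k).add_one.add_one).neg_one_pow, mul_zero, one_mul]
    exact ⟨rfl, rfl⟩
  · obtain ⟨ne, hW⟩ := E.divisionValue_addOrderOf hP hr hord
    have net : IsEllipticNet (E.divisionValue x y) := by
      have h2 := ne 2 (by omega) (by omega)
      rw [E.divisionValue_eq_normEDS] at h2 ⊢
      exact IsEllipticNet.normEDS _ _ (by simpa using h2)
    obtain ⟨A, B, hA, hB, h⟩ :=
      net.exists_apply_mul_add zero one (E.divisionValue_invariant hP.1) hr ne hW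
    -- Passing from ψ to F contributes the sign `(-1) ^ (k * r)`, which equals `((-1) ^ r) ^ k ^ 2`
    -- because `k` and `k ^ 2` have the same parity.
    refine ⟨Units.mk0 A hA, Units.mk0 ((-1) ^ r * B) (mul_ne_zero (by simp) hB),
      fun _ k n ↦ ?_, by omega⟩
    have hs : (-1 : F) ^ (k * r) = ((-1) ^ r) ^ k ^ 2 := by
      rcases Nat.even_or_odd k with hk | hk
      · rw [(hk.mul_right r).neg_one_pow, ← pow_mul,
          ((hk.pow_of_ne_zero two_ne_zero).mul_left r).neg_one_pow]
      · rw [mul_comm, pow_mul]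
        rcases neg_one_pow_eq_or F r with h | h <;> rw [h]
        · simp
        · rw [hk.neg_one_pow, hk.pow.neg_one_pow]
    rw [E.evalEval_divisionPoly, E.evalEval_divisionPoly, h, add_assoc, pow_add, hs]
    simp only [Units.val_mk0]
    ring
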